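/- **Definitions.** Alphabets are the nonempty finite sets $Q=\{0,\dots,q-1\}$. An automata network with $n$ nodes over $Q$ is a map $F:Q^n\to Q^n$; its orbit graph $G_F$ has vertex set $Q^n$ and an edge $x\to F(x)$ for each $x$. The transient length of $x$ is the least $t$ such that $F^t(x)$ is periodic. Letters of $Q$ are encoded in binary on $k_Q=\max(1,\lceil\log_2 q\rceil)$ bits, and configurations cell by cell. A circuit encoding of $F$ is a Boolean circuit (acyclic, with constant, NOT, AND and OR gates of fan-in at most 2, size = number of vertices including inputs) that computes $F$ on the encoded configurations. For $\rho:\mathbb N\to\mathbb N$, $G_F$ is *$\rho$-succinct* if $F$ has a circuit encoding of size at most $\rho(n)$. For networks $F$ with $n$ nodes and $H$ with $m$ nodes, $G_H$ *embeds $G_F$ with distortion* $\delta$ if $m\le\delta(n)$ and there is $1\le T\le\delta(n)$ such that $G_F$ is isomorphic to a subgraph of $G_{H^T}$. A *family* is a set $\mathcal F$ of automata networks over a fixed alphabet together with a standard representation: a language $L\subseteq\{0,1\}^*$ each of whose words $w$ represents one network $F_w\in\mathcal F$, every member of $\mathcal F$ being represented, and a deterministic logarithmic-space machine turning each $w\in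 L$ into a canonical description of a circuit encoding of $F_w$. A network $G$ with node set $V_G$ *simulates* a network $F$ with node set $V_F$ in time $T\ge1$ via a block embedding, given by a partition of $V_G$ into blocks $(D_i)_{i\in V_F}$ and patterns $p_{i,a}\in Q_G^{D_i}$ with $a\mapsto p_{i,a}$ injective for each $i$, if $\phi\circ F=G^T\circ\phi$, where $\phi(x)|_{D_i}=p_{i,x_i}$. A family simulates another one in time $T$ and space $S$ (functions $\mathbb N\to\mathbb N$) if a deterministic logarithmic-space machine turns every word representing a network $F$ of the second family, with $n$ nodes, into a word representing a network $G$ of the first one with $S(n)$ nodes, together with $T(n)$ and a block embedding via which $G$ simulates $F$ in time $T(n)$. For an alphabet $Q$, $\mathcal U_{Q,P}$ is the family of all networks over $Q$ with $n\ge1$ nodes that have a circuit encoding of size at most $P(n)$, represented by these circuits; $\mathcal B_{Q,\Delta}$ is the family of all networks over $Q$ with at least one node and a communication graph of maximum degree at most $\Delta$ (the next state of a node depends only on its in-neighbors in this graph; degrees count all in- and out-neighbors), represented by such a graph and the transition tables of the local maps. A family is *universal* if for every alphabet $Q$ and every polynomial $P$ it simulates $\mathcal U_{Q,P}$ in polynomial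 time and space, and *strongly universal* if for every alphabet $Q$ and every $\Delta\ge1$ it simulates $\mathcal B_{Q,\Delta}$ in linear time and space. Here "polynomial" and "linear" mean bounded by a polynomial, respectively by an affine map $n\mapsto cn+c$. **Theorem.** Let $\mathcal F$ be a family of automata networks. 1. Suppose that $\mathcal F$ is universal. Then for every polynomial $\rho$ there is a polynomial $\delta$ such that every $\rho$-succinct orbit graph of a network with at least one node (over any alphabet) is embedded with distortion $\delta$ by the orbit graph of some $H\in\mathcal F$. In particular $\mathcal F$ contains networks with super-polynomial periods and transients and a super-polynomial number of disjoint periodic orbits of at most polynomial period: there are $\alpha>0$ and a polynomial $L$ such that for every $M$ there is $H\in\mathcal F$ with $m\ge M$ nodes having a periodic orbit of period at least $2^{m^\alpha}$, a configuration of transient length at least $2^{m^\alpha}$, and at least $2^{m^\alpha}$ pairwise disjoint periodic orbits of period at most $L(m)$. 2. Suppose that $\mathcal F$ is strongly universal. Then for every alphabet $Q$ and every $\Delta\ge1$ there is a linear $\delta$ such that for every $F\in\mathcal B_{Q,\Delta}$ the orbit graph $G_F$ is embedded with distortion $\delta$ by the orbit graph of some $H\in\mathcal F$. In particular there are $\alpha>0$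 and a linear $L$ such that for every $M$ there is $H\in\mathcal F$ with $m\ge M$ nodes having a periodic orbit of period at least $2^{\alpha m}$, a configuration of transient length at least $2^{\alpha m}$, and at least $2^{\alpha m}$ pairwise disjoint periodic orbits of period at most $L(m)$. -/

import Mathlib

namespace AutomataNet

/-! ### Automata networks and their dynamics -/

/-- Configurations over the alphabet `{0, …, q - 1}` on the node set `{0, …, n - 1}`. -/
abbrev Config (q n : ℕ) : Type := Fin n → Fin q

/-- An abstract automata network over the alphabet `Fin q`: a number of nodes and a global map. -/
structure Network (q : ℕ) where
  nodes : ℕ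
  map : Config q nodes → Config q nodes

/-- The orbit graph of a map: an edge from `x` to `f x` for each vertex `x`. -/
def orbitGraph {X : Type*} (f : X → X) : Digraph X where
  Adj x y := y = f x

/-- `A` is (isomorphic to) a subgraph of `B`. -/
def IsSubgraphOf {X Y : Type*} (A : Digraph X) (B : Digraph Y) : Prop :=
  ∃ e : X → Y, Function.Injective e ∧ ∀ x y, A.Adj x y → B.Adj (e x) (e y)

/-- The set of points visited by the orbit of `x`. -/
def orbitSet {X : Type*} (f : X → X) (x : X) : Set X := Set.range fun t : ℕ => f^[t] x

/-- The transient length of the orbit of `x`: the first time at which it reaches a periodic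
point (such a time exists on a finite set). -/
noncomputable def transientLength {X : Type*} (f : X → X) (x : X) : ℕ :=
  sInf {t : ℕ | f^[t] x ∈ Function.periodicPts f}

/-- `f` has `b` or more pairwise disjoint periodic orbits, each of period at most `L`. -/
def HasManyShortOrbits {X : Type*} (f : X → X) (b : ℝ) (L : ℕ) : Prop :=
  ∃ S : Finset (Set X), b ≤ (S.card : ℝ) ∧
    (S : Set (Set X)).Pairwise Disjoint ∧
    ∀ O ∈ S, ∃ x ∈ Function.periodicPts f, Function.minimalPeriod f x ≤ L ∧ O = orbitSet f x

/-- `H` has a periodic orbit of period at least `b`, an orbit of transient length at least `b`,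
and at least `b` pairwise disjoint periodic orbits of period at most `L`. -/
def HasRichDynamics {q : ℕ} (H : Network q) (b : ℝ) (L : ℕ) : Prop :=
  (∃ x ∈ Function.periodicPts H.map, b ≤ (Function.minimalPeriod H.map x : ℝ)) ∧
  (∃ x, b ≤ (transientLength H.map x : ℝ)) ∧
  HasManyShortOrbits H.map b L

/-- `G_H` embeds `G_F` with distortion `δ`. -/
def EmbedsWithDistortion (δ : ℕ → ℕ) {qF qH : ℕ} (F : Network qF) (H : Network qH) : Prop :=
  H.nodes ≤ δ F.nodes ∧
  ∃ T : ℕ, 0 < T ∧ T ≤ δ F.nodes ∧ IsSubgraphOf (orbitGraph F.map) (orbitGraph H.map^[T])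

/-! ### Growth of functions -/

/-- `f` is bounded by a polynomial. -/
def IsPolyBounded (f : ℕ → ℕ) : Prop := ∃ p : Polynomial ℕ, ∀ n, f n ≤ p.eval n

/-- `f` is bounded by an affine map. -/
def IsLinearlyBounded (f : ℕ → ℕ) : Prop := ∃ c : ℕ, ∀ n, f n ≤ c * n + c

/-! ### Words -/

/-- Binary words. -/
abbrev Word : Type := List Bool

/-- Self-delimiting code of a binary word. -/
def wordCode (w : Word) : Word := w.flatMap (fun b => [true, b]) ++ [false]

/-- Self-delimiting code of a natural number, through its binary expansion. -/
def natCode (n : ℕ) : Word := wordCode n.bits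

/-! ### Logarithmic space Turing machines -/

/-- What the input head can read: an end marker or a letter of the input. -/
inductive InputSymbol where
  | leftEnd
  | letter (b : Bool)
  | rightEnd

/-- Moves of a head. -/
inductive Move where
  | left
  | stay
  | right

/-- A deterministic Turing machine with a read-only input tape, a two-way infinite work tape over
the alphabet `Fin (symbols + 1)` with blank `0`, and a write-only output tape. -/
structure Transducer where
  states : ℕ
  symbols : ℕ
  start : Fin states
  halt : Fin states
  trans : Fin states → InputSymbol → Fin (symbols + 1) →
    Fin states × Fin (symbols + 1) × Move × Move × Option Bool

/-- Instantaneous descriptions of a transducer. -/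
structure Transducer.Snapshot (M : Transducer) where
  state : Fin M.states
  inputPos : ℕ
  workPos : ℤ
  work : ℤ → Fin (M.symbols + 1)
  output : Word

/-- The input tape carries `w` on cells `1, …, w.length`, between the two end markers. -/
def readInput (w : Word) (i : ℕ) : InputSymbol :=
  if i = 0 then .leftEnd else
    match w[i - 1]? with
    | some b => .letter b
    | none => .rightEnd

/-- The input head stays between the end markers, on cells `0, …, w.length + 1`. -/
def moveInput (w : Word) (i : ℕ) : Move → ℕ
  | .left => i - 1
  | .stay => i
  | .right => min (i + 1) (w.length + 1)

/-- Move of the work head. -/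
def moveWork (i : ℤ) : Move → ℤ
  | .left => i - 1
  | .stay => i
  | .right => i + 1

/-- Initial description. -/
def Transducer.init (M : Transducer) : M.Snapshot where
  state := M.start
  inputPos := 0
  workPos := 0
  work := fun _ => 0
  output := []

/-- One step of computation on the input `w`; nothing changes in the halting state. -/
def Transducer.step (M : Transducer) (w : Word) (c : M.Snapshot) : M.Snapshot :=
  if c.state = M.halt then c else
    let a := M.trans c.state (readInput w c.inputPos) (c.work c.workPos)
    { state := a.1
      inputPos := moveInput w c.inputPos a.2.2.1
      workPos := moveWork c.workPos a.2.2.2.1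
      work := Function.update c.work c.workPos a.2.1
      output := c.output ++ a.2.2.2.2.toList }

/-- The function `f` is computed on the words of `L` by a deterministic Turing machine that works
in logarithmic space. -/
def IsLogSpaceOn (L : Set Word) (f : Word → Word) : Prop :=
  ∃ (M : Transducer) (c : ℕ), ∀ w ∈ L,
    (∃ t, ((M.step w)^[t] M.init).state = M.halt ∧ ((M.step w)^[t] M.init).output = f w) ∧
    ∀ t, ((M.step w)^[t] M.init).workPos.natAbs ≤ c * (Nat.log 2 w.length + 1)

/-! ### Boolean circuits -/

/-- Gates whose inputs are taken in a set `V` of vertices. -/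
inductive Gate (V : Type) where
  | const (b : Bool)
  | not (u : V)
  | and (u v : V)
  | or (u v : V)

/-- The vertices a gate reads. -/
def Gate.sources {V : Type} : Gate V → List V
  | .const _ => []
  | .not u => [u]
  | .and u v => [u, v]
  | .or u v => [u, v]

/-- The value of a gate, given the values of the vertices it reads. -/
def Gate.value {V : Type} : (g : Gate V) → ((u : V) → u ∈ g.sources → Bool) → Bool
  | .const b, _ => b
  | .not u, f => !(f u (by simp [Gate.sources]))
  | .and u v, f => f u (by simp [Gate.sources]) && f v (by simp [Gate.sources])
  | .or u v, f => f u (by simp [Gate.sources]) || f v (by simp [Gate.sources])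

/-- Boolean circuits with `I` input vertices and `O` outputs. -/
structure Circuit (I O : ℕ) where
  gates : ℕ
  gate : Fin gates → Gate (Fin I ⊕ Fin gates)
  out : Fin O → Fin I ⊕ Fin gates
  acyclic : WellFounded fun i j : Fin gates => Sum.inr i ∈ (gate j).sources

namespace Circuit

variable {I O : ℕ}

/-- The size of a circuit is its number of vertices, inputs included. -/
def size (C : Circuit I O) : ℕ := I + C.gates

/-- Values of the gates on the input `x`. -/
noncomputable def gateValue (C : Circuit I O) (x : Fin I → Bool) : Fin C.gates → Bool :=
  C.acyclic.fix fun j rec => (C.gate j).value fun u hu =>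
    match u, hu with
    | .inl i, _ => x i
    | .inr i, hi => rec i hi

/-- Values of all the vertices on the input `x`. -/
noncomputable def vertexValue (C : Circuit I O) (x : Fin I → Bool) : Fin I ⊕ Fin C.gates → Bool :=
  Sum.elim x (C.gateValue x)

theorem vertexValue_inr (C : Circuit I O) (x : Fin I → Bool) (j : Fin C.gates) :
    C.vertexValue x (.inr j) = (C.gate j).value fun u _ => C.vertexValue x u := by
  change C.gateValue x j = _
  unfold gateValue
  rw [WellFounded.fix_eq]
  congr 1
  funext u hu
  cases u <;> rfl

/-- The Boolean function computed by the circuit. -/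
noncomputable def eval (C : Circuit I O) (x : Fin I → Bool) : Fin O → Bool :=
  fun o => C.vertexValue x (C.out o)

/-- Code of a vertex: inputs are numbered first, then gates. -/
def vertexCode {g : ℕ} : Fin I ⊕ Fin g → Word
  | .inl i => natCode i
  | .inr j => natCode (I + j)

/-- Code of a gate: its type and the vertices it reads. -/
def gateCode {g : ℕ} : Gate (Fin I ⊕ Fin g) → Word
  | .const b => natCode 0 ++ [b]
  | .not u => natCode 1 ++ vertexCode u
  | .and u v => natCode 2 ++ vertexCode u ++ vertexCode v
  | .or u v => natCode 3 ++ vertexCode u ++ vertexCode v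

/-- Canonical representation of a circuit as a word. -/
def code (C : Circuit I O) : Word :=
  natCode I ++ natCode O ++ natCode C.gates ++
    (List.ofFn fun j => gateCode (C.gate j)).flatten ++
    (List.ofFn fun o => vertexCode (C.out o)).flatten

end Circuit

/-- Number of bits used for one letter of the alphabet `Fin q`. -/
def bitWidth (q : ℕ) : ℕ := max 1 (Nat.clog 2 q)

/-- Cell-wise binary encoding of configurations. -/
def configBits {q n : ℕ} (x : Config q n) : Fin (n * bitWidth q) → Bool :=
  fun j => (x j.divNat : ℕ).testBit (j.modNat : ℕ)

/-- `C` is a circuit encoding of the map `F`. -/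
def EncodesMap {q n : ℕ} (C : Circuit (n * bitWidth q) (n * bitWidth q))
    (F : Config q n → Config q n) : Prop :=
  ∀ x, C.eval (configBits x) = configBits (F x)

/-- `F` can be represented by a circuit of size at most `ρ n`, with `n` its number of nodes: its
orbit graph is `ρ`-succinct. -/
def IsSuccinct (ρ : ℕ → ℕ) {q : ℕ} (F : Network q) : Prop :=
  ∃ C : Circuit (F.nodes * bitWidth q) (F.nodes * bitWidth q),
    EncodesMap C F.map ∧ C.size ≤ ρ F.nodes

/-! ### Families of automata networks with a representation -/

/-- A set of automata networks over the alphabet `Fin q`, and a relation saying which words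
represent which networks. -/
structure Family (q : ℕ) where
  nets : Set (Network q)
  Represents : Word → Network q → Prop

/-- The language of the words that represent some network. -/
def Family.lang {q : ℕ} (A : Family q) : Set Word := {w | ∃ F, A.Represents w F}

/-- The representation is standard: each word of the language represents exactly one network, which
belongs to the family, each network of the family is represented, and a logarithmic space machine
turns each word `w` of the language into the canonical representation of a circuit encoding of the
network represented by `w`. -/
structure Family.IsStandard {q : ℕ} (A : Family q) : Prop where
  mem : ∀ w F, A.Represents w F → F ∈ A.nets
  unique : ∀ w F G, A.Represents w F → A.Represents w G → F = G
  exists_word : ∀ F ∈ A.nets, ∃ w, A.Represents w F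
  circuit : ∃ f : Word → Word, IsLogSpaceOn A.lang f ∧
    ∀ w F, A.Represents w F →
      ∃ C : Circuit (F.nodes * bitWidth q) (F.nodes * bitWidth q),
        EncodesMap C F.map ∧ f w = C.code

/-- The family of all networks with at least one node that have a circuit encoding of size at most
`P n`, with `n` the number of nodes, represented by these circuits. -/
def circuitFamily (q : ℕ) (P : ℕ → ℕ) : Family q where
  nets := {F | 0 < F.nodes ∧ IsSuccinct P F}
  Represents w F := 0 < F.nodes ∧
    ∃ C : Circuit (F.nodes * bitWidth q) (F.nodes * bitWidth q),
      EncodesMap C F.map ∧ C.size ≤ P F.nodes ∧ w = C.code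

/-- `G` is a communication graph of `F`: the new state of a node depends only on the states of its
in-neighbors in `G`. -/
def IsCommunicationGraph {q n : ℕ} (G : Digraph (Fin n)) (F : Config q n → Config q n) : Prop :=
  ∀ v, ∃ f : ({u // G.Adj u v} → Fin q) → Fin q, ∀ x, F x v = f fun u => x u

/-- The degree of each node of `G` is at most `Δ`; edges are counted in both directions. -/
def DegreeLE {n : ℕ} (G : Digraph (Fin n)) (Δ : ℕ) : Prop :=
  ∀ v, {u | G.Adj u v ∨ G.Adj v u}.ncard ≤ Δ

/-- Graph and local maps of a network: `nbr v` lists the in-neighbors of `v`, and `loc v` gives the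
new state of `v` as a function of their states. -/
structure LocalData (q n : ℕ) where
  deg : Fin n → ℕ
  nbr : (v : Fin n) → Fin (deg v) → Fin n
  nbr_injective : ∀ v, Function.Injective (nbr v)
  loc : (v : Fin n) → (Fin (deg v) → Fin q) → Fin q

namespace LocalData

variable {q n : ℕ}

/-- The graph given by the lists of in-neighbors. -/
def graph (R : LocalData q n) : Digraph (Fin n) where
  Adj u v := u ∈ Set.range (R.nbr v)

/-- The global map given by the local maps. -/
def map (R : LocalData q n) : Config q n → Config q n :=
  fun x v => R.loc v fun i => x (R.nbr v i)

/-- Code of the graph (lists of in-neighbors) and of the plain transition tables. -/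
def code (R : LocalData q n) : Word :=
  natCode n ++
  (List.ofFn fun v => natCode (R.deg v) ++
    (List.ofFn fun i => natCode (R.nbr v i)).flatten).flatten ++
  (List.ofFn fun v =>
    (List.ofFn fun j : Fin (q ^ R.deg v) =>
      natCode (R.loc v (finFunctionFinEquiv.symm j))).flatten).flatten

end LocalData

/-- The family of networks with at least one node that have a communication graph of degree at most
`Δ`, represented by such a graph and the tables of the local maps. -/
def boundedDegreeFamily (q Δ : ℕ) : Family q where
  nets := {F | 0 < F.nodes ∧ ∃ G, IsCommunicationGraph G F.map ∧ DegreeLE G Δ}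
  Represents w F := 0 < F.nodes ∧
    ∃ R : LocalData q F.nodes, DegreeLE R.graph Δ ∧ R.map = F.map ∧ w = R.code

/-! ### Simulation and universality -/

/-- Block embeddings of `Config qF nF` into `Config qG nG`: `block` sends each node to the index of
its block, so that the blocks partition the nodes, and `pattern i` encodes the states of `i` into
patterns on the `i`-th block. -/
structure BlockEmbedding (qF nF qG nG : ℕ) where
  block : Fin nG → Fin nF
  pattern : (i : Fin nF) → Fin qF → ({v // block v = i} → Fin qG)
  pattern_injective : ∀ i, Function.Injective (pattern i)

namespace BlockEmbedding

variable {qF nF qG nG : ℕ}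

/-- The map on configurations defined by a block embedding. -/
def toFun (φ : BlockEmbedding qF nF qG nG) (x : Config qF nF) : Config qG nG :=
  fun v => φ.pattern (φ.block v) (x (φ.block v)) ⟨v, rfl⟩

/-- Representation of a block embedding: the list of the blocks and the list of the patterns, node
by node. -/
def code (φ : BlockEmbedding qF nF qG nG) : Word :=
  natCode nF ++ natCode nG ++
  (List.ofFn fun v => natCode (φ.block v)).flatten ++
  (List.ofFn fun a =>
    (List.ofFn fun v => natCode (φ.pattern (φ.block v) a ⟨v, rfl⟩)).flatten).flatten

end BlockEmbedding

/-- `G` simulates `F` in time `T` via the block embedding `φ`. -/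
def SimulatesVia {qF qG : ℕ} (G : Network qG) (F : Network qF)
    (φ : BlockEmbedding qF F.nodes qG G.nodes) (T : ℕ) : Prop :=
  0 < T ∧ ∀ x, φ.toFun (F.map x) = G.map^[T] (φ.toFun x)

/-- The family `A` simulates the family `B` in time `T` and space `S`: a logarithmic space machine
turns each word representing a network `F` of `B` with `n` nodes into a word representing a network
`G` of `A` with `S n` nodes, the number `T n`, and a block embedding via which `G` simulates `F` in
time `T n`. -/
def Family.Simulates {qA qB : ℕ} (A : Family qA) (B : Family qB) (T S : ℕ → ℕ) : Prop :=
  ∃ f : Word → Word, IsLogSpaceOn B.lang f ∧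
    ∀ w F, B.Represents w F →
      ∃ (u : Word) (G : Network qA) (φ : BlockEmbedding qB F.nodes qA G.nodes),
        A.Represents u G ∧ G.nodes = S F.nodes ∧ SimulatesVia G F φ (T F.nodes) ∧
        f w = wordCode u ++ natCode (T F.nodes) ++ φ.code

/-- Universal families. -/
def Family.IsUniversal {q : ℕ} (A : Family q) : Prop :=
  ∀ k : ℕ, 0 < k → ∀ P, IsPolyBounded P →
    ∃ T S, IsPolyBounded T ∧ IsPolyBounded S ∧ A.Simulates (circuitFamily k P) T S

/-- Strongly universal families. -/
def Family.IsStronglyUniversal {q : ℕ} (A : Family q) : Prop :=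
  ∀ k : ℕ, 0 < k → ∀ Δ : ℕ, 1 ≤ Δ →
    ∃ T S, IsLinearlyBounded T ∧ IsLinearlyBounded S ∧ A.Simulates (boundedDegreeFamily k Δ) T S

end AutomataNet

open AutomataNet

namespace AutomataNet

/-! ### Transfer of dynamics along injective semiconjugacies -/

section Transfer

variable {X Y : Type*} {f : X → X} {g : Y → Y} {φ : X → Y} {T : ℕ}

/-! A simulation in time `T` via a block embedding is an injective semiconjugacy `φ` from `F` to
`G^T`. It embeds the orbit graph of `F` into that of `G^T`, and it transfers dynamics to `G`: a
return of `φ x` under `G` forces a return of `x` under `F`, so periods and transients do not shrink,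
while fixed points of `F` become points fixed by `G^T`, at most `T` of them on each orbit of `G`.

The strongly universal embedding statement is then immediate. In the universal case a single `δ`
must serve all alphabets, whereas universality gives one pair of bounds per alphabet. Every network
is therefore first replaced by the binary network that its circuit defines on encoded configurations
(`exists_binary_network`). The size of the circuit bounds the number of nodes of that network, so
`δ` is a composite of polynomials.

For the rich dynamics, one network serves both cases: a pipelined binary counter with `n` digits,
between a constant source and a latch. Cells read only themselves and their left neighbor, so the
degree is bounded and circuits have linear size. With the source on, the number held grows by one
per step, up to multiples of `2 ^ n` leaving at the last digit; so periods are multiples of `2 ^ n`.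
From zero, the latch stays clear until the first overflow and never clears afterwards, which gives a
transient of length at least `2 ^ n`. Without carries nothing moves, which gives exponentially many
fixed points. For large `n`, half of the exponent `n` pays for the factor `T` lost on orbits, and
`α` turns the other half into a function of the number of nodes of the simulating network. -/

theorem exists_iterate_mem_periodicPts [Finite X] (f : X → X) (x : X) :
    ∃ t, f^[t] x ∈ Function.periodicPts f := by
  obtain ⟨a, b, hab, h⟩ := Finite.exists_ne_map_eq_of_infinite fun t : ℕ => f^[t] x
  have key : ∀ a b : ℕ, a < b → f^[a] x = f^[b] x → ∃ t, f^[t] x ∈ Function.periodicPts f := by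
    intro a b hlt h
    refine ⟨a, Function.mk_mem_periodicPts (Nat.sub_pos_of_lt hlt) ?_⟩
    change f^[b - a] (f^[a] x) = f^[a] x
    rw [← Function.iterate_add_apply, Nat.sub_add_cancel hlt.le, h]
  rcases lt_or_gt_of_ne hab with hlt | hlt
  · exact key a b hlt h
  · exact key b a hlt h.symm

theorem le_transientLength [Finite X] {f : X → X} {x : X} {b : ℕ}
    (h : ∀ t, f^[t] x ∈ Function.periodicPts f → b ≤ t) : b ≤ transientLength f x :=
  h _ (Nat.sInf_mem (s := {t : ℕ | f^[t] x ∈ Function.periodicPts f})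
    (exists_iterate_mem_periodicPts f x))

theorem mem_periodicPts_of_semiconj (h : Function.Semiconj φ f g^[T]) (hT : 0 < T) {x : X}
    (hx : x ∈ Function.periodicPts f) : φ x ∈ Function.periodicPts g := by
  obtain ⟨p, hp, hpx⟩ := hx
  have := hpx.map h
  refine ⟨T * p, Nat.mul_pos hT hp, ?_⟩
  change g^[T * p] (φ x) = φ x
  rw [Function.iterate_mul]
  exact this

/-- If `g^p` fixes `φ x`, so does `g^(T * p)`, which acts on the image of `φ` as `f^p`. The same `p`
works, even when it is not a multiple of `T`. -/
theorem isPeriodicPt_of_semiconj (h : Function.Semiconj φ f g^[T]) (hφ : Function.Injective φ)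
    {x : X} {p : ℕ} (hp : Function.IsPeriodicPt g p (φ x)) : Function.IsPeriodicPt f p x := by
  apply hφ
  have h1 := (h.iterate_right p).eq x
  rw [h1, ← Function.iterate_mul, mul_comm]
  exact hp.mul_const T

theorem minimalPeriod_le_of_semiconj (h : Function.Semiconj φ f g^[T]) (hT : 0 < T)
    (hφ : Function.Injective φ) {x : X} (hx : x ∈ Function.periodicPts f) :
    Function.minimalPeriod f x ≤ Function.minimalPeriod g (φ x) :=
  (isPeriodicPt_of_semiconj h hφ (Function.isPeriodicPt_minimalPeriod g (φ x))).minimalPeriod_le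
    (Function.minimalPeriod_pos_of_mem_periodicPts (mem_periodicPts_of_semiconj h hT hx))

theorem transientLength_le_of_semiconj [Finite Y] (h : Function.Semiconj φ f g^[T])
    (hT : 0 < T) (hφ : Function.Injective φ) (x : X) :
    transientLength f x ≤ transientLength g (φ x) := by
  refine le_transientLength fun t ht => Nat.sInf_le ?_
  obtain ⟨p, hp, hpx⟩ := ht
  refine ⟨p, hp, isPeriodicPt_of_semiconj h hφ ?_⟩
  -- The image of `f^[t] x` lies at time `T * t ≥ t` on the orbit of `φ x`, hence after the entrance
  -- into the cycle.
  rw [(h.iterate_right t).eq x, ← Function.iterate_mul]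
  have hle : t ≤ T * t := Nat.le_mul_of_pos_left t hT
  rw [← Nat.sub_add_cancel hle, Function.iterate_add_apply]
  exact hpx.apply_iterate _

theorem self_mem_orbitSet (g : Y → Y) (y : Y) : y ∈ orbitSet g y := ⟨0, rfl⟩

theorem orbitSet_iterate {y : Y} (hy : y ∈ Function.periodicPts g) (t : ℕ) :
    orbitSet g (g^[t] y) = orbitSet g y := by
  obtain ⟨p, hp, hpy⟩ := hy
  apply Set.Subset.antisymm
  · rintro _ ⟨s, rfl⟩
    exact ⟨s + t, Function.iterate_add_apply g s t y⟩
  · rintro _ ⟨s, rfl⟩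
    -- Going on for `p * t - t` steps completes `t` full turns and so undoes the first `t` steps.
    refine ⟨s + (p * t - t), ?_⟩
    have hle : t ≤ p * t := Nat.le_mul_of_pos_left t hp
    change g^[s + (p * t - t)] (g^[t] y) = g^[s] y
    rw [← Function.iterate_add_apply, add_assoc, Nat.sub_add_cancel hle,
      Function.iterate_add_apply]
    congr 1
    exact hpy.mul_const t

theorem orbitSet_eq_or_disjoint {y z : Y} (hy : y ∈ Function.periodicPts g)
    (hz : z ∈ Function.periodicPts g) :
    orbitSet g y = orbitSet g z ∨ Disjoint (orbitSet g y) (orbitSet g z) := by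
  by_cases hd : Disjoint (orbitSet g y) (orbitSet g z)
  · exact Or.inr hd
  · obtain ⟨_, ⟨s, rfl⟩, ⟨t, ht⟩⟩ := Set.not_disjoint_iff.mp hd
    left
    rw [← orbitSet_iterate hy s, ← orbitSet_iterate hz t]
    exact congrArg _ ht.symm

theorem orbitSet_subset_image {y : Y} {p : ℕ} (hp : 0 < p) (hy : Function.IsPeriodicPt g p y) :
    orbitSet g y ⊆ (fun t => g^[t] y) '' (Finset.range p : Set ℕ) := by
  rintro _ ⟨t, rfl⟩
  exact ⟨t % p, by simpa using Nat.mod_lt t hp, hy.iterate_mod_apply t⟩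

/-- Fixed points of `f` give short disjoint orbits of `g`, at most `T` of them on each orbit. -/
theorem hasManyShortOrbits_of_semiconj (h : Function.Semiconj φ f g^[T]) (hT : 0 < T)
    (hφ : Function.Injective φ) (s : Finset X) (hs : ∀ x ∈ s, f x = x) {b : ℝ}
    (hb : b * T ≤ s.card) {L : ℕ} (hL : T ≤ L) : HasManyShortOrbits g b L := by
  classical
  have hper : ∀ x ∈ s, Function.IsPeriodicPt g T (φ x) := fun x hx => by
    change g^[T] (φ x) = φ x
    rw [← h.eq x, hs x hx]
  refine ⟨s.image fun x => orbitSet g (φ x), ?_, ?_, ?_⟩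
  -- The map `x ↦ orbitSet g (φ x)` has fibers of size at most `T`: `φ` sends a fiber injectively
  -- into one orbit, which has at most `T` points.
  · have hcard : s.card ≤ T * (s.image fun x => orbitSet g (φ x)).card := by
      refine Finset.card_le_mul_card_image s T fun O hO => ?_
      obtain ⟨x, hx, rfl⟩ := Finset.mem_image.mp hO
      calc (s.filter fun y => orbitSet g (φ y) = orbitSet g (φ x)).card
          ≤ ((Finset.range T).image fun t => g^[t] (φ x)).card := by
            refine Finset.card_le_card_of_injOn φ ?_ hφ.injOn
            intro y hy
            have hy' := (Finset.mem_filter.mp (Finset.mem_coe.mp hy)).2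
            have hmem : φ y ∈ orbitSet g (φ x) := hy' ▸ self_mem_orbitSet g (φ y)
            simpa using orbitSet_subset_image hT (hper x hx) hmem
        _ ≤ T := Finset.card_image_le.trans (Finset.card_range T).le
    have hT' : (0 : ℝ) < T := by exact_mod_cast hT
    have hcard' : (s.card : ℝ) ≤ T * ((s.image fun x => orbitSet g (φ x)).card : ℝ) := by
      exact_mod_cast hcard
    refine le_of_mul_le_mul_right ?_ hT'
    linarith
  · intro O hO O' hO' hne
    obtain ⟨x, hx, rfl⟩ := Finset.mem_image.mp (Finset.mem_coe.mp hO)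
    obtain ⟨y, hy, rfl⟩ := Finset.mem_image.mp (Finset.mem_coe.mp hO')
    exact (orbitSet_eq_or_disjoint ⟨T, hT, hper x hx⟩ ⟨T, hT, hper y hy⟩).resolve_left hne
  · intro O hO
    obtain ⟨x, hx, rfl⟩ := Finset.mem_image.mp hO
    exact ⟨φ x, ⟨T, hT, hper x hx⟩, ((hper x hx).minimalPeriod_le hT).trans hL, rfl⟩

end Transfer

/-! ### Simulations and embeddings of orbit graphs -/

namespace BlockEmbedding

variable {qF nF qG nG : ℕ}

theorem toFun_injective (φ : BlockEmbedding qF nF qG nG) : Function.Injective φ.toFun := by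
  intro x y h
  funext i
  refine φ.pattern_injective i (funext ?_)
  rintro ⟨v, rfl⟩
  exact congrFun h v

theorem block_surjective (φ : BlockEmbedding qF nF qG nG) (hq : 2 ≤ qF) :
    Function.Surjective φ.block := by
  intro i
  by_contra hi
  have : IsEmpty {v // φ.block v = i} := ⟨fun v => hi ⟨v.1, v.2⟩⟩
  have h := φ.pattern_injective i (Subsingleton.elim
    (φ.pattern i ⟨0, by omega⟩) (φ.pattern i ⟨1, by omega⟩))
  simp at h

/-- With two letters or more, injective patterns need nonempty blocks. Hence simulating large
counters produces networks with arbitrarily many nodes. -/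
theorem nodes_le (φ : BlockEmbedding qF nF qG nG) (hq : 2 ≤ qF) : nF ≤ nG := by
  simpa using Fintype.card_le_of_surjective _ (φ.block_surjective hq)

end BlockEmbedding

theorem SimulatesVia.semiconj {qF qG : ℕ} {G : Network qG} {F : Network qF}
    {φ : BlockEmbedding qF F.nodes qG G.nodes} {T : ℕ} (h : SimulatesVia G F φ T) :
    Function.Semiconj φ.toFun F.map G.map^[T] := h.2

theorem isSubgraphOf_of_semiconj {X Y : Type*} {f : X → X} {g : Y → Y} {φ : X → Y}
    (h : Function.Semiconj φ f g) (hφ : Function.Injective φ) :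
    IsSubgraphOf (orbitGraph f) (orbitGraph g) := by
  refine ⟨φ, hφ, ?_⟩
  rintro x _ rfl
  exact h.eq x

theorem IsSubgraphOf.trans {X Y Z : Type*} {A : Digraph X} {B : Digraph Y} {C : Digraph Z}
    (h : IsSubgraphOf A B) (h' : IsSubgraphOf B C) : IsSubgraphOf A C := by
  obtain ⟨e, he, hA⟩ := h
  obtain ⟨e', he', hB⟩ := h'
  exact ⟨e' ∘ e, he'.comp he, fun x y hxy => hB _ _ (hA x y hxy)⟩

theorem SimulatesVia.hasRichDynamics {qF qG : ℕ} {G : Network qG} {F : Network qF}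
    {φ : BlockEmbedding qF F.nodes qG G.nodes} {T : ℕ} (h : SimulatesVia G F φ T) {N : ℕ}
    {b : ℝ} (hb₀ : 0 ≤ b) (hb : b * T ≤ N)
    (hper : ∃ x ∈ Function.periodicPts F.map, N ≤ Function.minimalPeriod F.map x)
    (htr : ∃ x, N ≤ transientLength F.map x)
    (s : Finset (Config qF F.nodes)) (hs : ∀ x ∈ s, F.map x = x) (hcard : N ≤ s.card)
    {L : ℕ} (hL : T ≤ L) : HasRichDynamics G b L := by
  have hT : (1 : ℝ) ≤ T := by exact_mod_cast h.1
  have hbN : b ≤ N := le_trans (by nlinarith) hb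
  refine ⟨?_, ?_, ?_⟩
  · obtain ⟨x, hx, hp⟩ := hper
    refine ⟨_, mem_periodicPts_of_semiconj h.semiconj h.1 hx, hbN.trans ?_⟩
    exact_mod_cast hp.trans (minimalPeriod_le_of_semiconj h.semiconj h.1 φ.toFun_injective hx)
  · obtain ⟨x, hx⟩ := htr
    refine ⟨φ.toFun x, hbN.trans ?_⟩
    exact_mod_cast hx.trans (transientLength_le_of_semiconj h.semiconj h.1 φ.toFun_injective x)
  · exact hasManyShortOrbits_of_semiconj h.semiconj h.1 φ.toFun_injective s hs
      (hb.trans (by exact_mod_cast hcard)) hL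

/-! ### A bounded degree network with rich dynamics -/

/-- New state of a cell of the counter: `s / 2` is the carry emitted by a cell in state `s`, and the
carry of the previous cell, in state `p`, is added to the digit `s % 2`. -/
def addCarry (s p : Fin 4) : Fin 4 := ⟨s % 2 + p / 2, by omega⟩

/-- New state of a cell that keeps a carry for ever. -/
def latchCarry (s p : Fin 4) : Fin 4 :=
  ⟨max (s % 2 : ℕ) (p / 2) + 2 * min (s % 2 : ℕ) (p / 2), by omega⟩

/-- The local rule of the `i`-th cell: a constant source, then `n` cells of a counter, then a
latch. -/
def counterRule (n i : ℕ) (s p : Fin 4) : Fin 4 :=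
  if i = 0 then s else if i ≤ n then addCarry s p else latchCarry s p

/-- The cell on the left of `i`; the first cell is its own predecessor. -/
def predCell {n : ℕ} (i : Fin n) : Fin n := ⟨i - 1, by omega⟩

/-- A pipelined binary counter with `n` digits, between a source and a latch. -/
def counterMap (n : ℕ) (x : Config 4 (n + 2)) : Config 4 (n + 2) :=
  fun i => counterRule n i (x i) (x (predCell i))

/-- The counter as a network. -/
def counter (n : ℕ) : Network 4 where
  nodes := n + 2
  map := counterMap n

/-- The state of the `i`-th cell as a natural number. -/
def cellState {n : ℕ} (x : Config 4 n) (i : ℕ) : ℕ := if h : i < n then (x ⟨i, h⟩ : ℕ) else 0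

/-- The number held by the digits of the counter, pending carries included. -/
def counterValue {n : ℕ} (m : ℕ) (x : Config 4 n) : ℕ :=
  ∑ i ∈ Finset.range m, 2 ^ i * cellState x (i + 1)

/-- Conservation law of the counter: a state `s` splits as `s % 2 + 2 * (s / 2)`, and a carry
leaving weight `2 ^ i` counts for one unit at weight `2 ^ (i + 1)`. Only the two ends contribute:
the carry entering from cell `0` and the one leaving cell `n`. -/
theorem sum_addCarry (s : ℕ → ℕ) (n : ℕ) :
    ∑ i ∈ Finset.range n, 2 ^ i * (s (i + 1) % 2 + s i / 2) + 2 ^ n * (s n / 2) =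
      ∑ i ∈ Finset.range n, 2 ^ i * s (i + 1) + s 0 / 2 := by
  induction n with
  | zero => simp
  | succ n ih =>
    rw [Finset.sum_range_succ, Finset.sum_range_succ]
    have h := congrArg (2 ^ n * ·) (Nat.mod_add_div (s (n + 1)) 2)
    simp only [mul_add] at h ⊢
    simp only [mul_add] at ih
    rw [pow_succ]
    linarith

section Counter

variable {n : ℕ}

theorem cellState_map (x : Config 4 (n + 2)) {i : ℕ} (hi : i < n) :
    cellState (counterMap n x) (i + 1) = cellState x (i + 1) % 2 + cellState x i / 2 := by
  have h1 : i + 1 < n + 2 := by omega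
  have h2 : i < n + 2 := by omega
  have h3 : i + 1 ≤ n := hi
  simp [cellState, h1, h2, counterMap, counterRule, addCarry, predCell, h3]

theorem cellState_map_zero (x : Config 4 (n + 2)) :
    cellState (counterMap n x) 0 = cellState x 0 := by
  simp [cellState, counterMap, counterRule]

theorem cellState_iterate_zero (x : Config 4 (n + 2)) (t : ℕ) :
    cellState ((counterMap n)^[t] x) 0 = cellState x 0 := by
  induction t with
  | zero => rfl
  | succ t ih => rw [Function.iterate_succ_apply', cellState_map_zero]; exact ih

theorem cellState_map_latch (x : Config 4 (n + 2)) :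
    cellState (counterMap n x) (n + 1) =
      max (cellState x (n + 1) % 2) (cellState x n / 2) +
        2 * min (cellState x (n + 1) % 2) (cellState x n / 2) := by
  simp [cellState, counterMap, counterRule, latchCarry, predCell]

theorem cellState_lt (x : Config 4 n) (i : ℕ) : cellState x i < 4 := by
  unfold cellState
  split <;> omega

theorem counterValue_map (x : Config 4 (n + 2)) :
    counterValue n (counterMap n x) + 2 ^ n * (cellState x n / 2) =
      counterValue n x + cellState x 0 / 2 := by
  rw [counterValue, counterValue, ← sum_addCarry]
  congr 1
  refine Finset.sum_congr rfl fun i hi => ?_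
  rw [cellState_map x (Finset.mem_range.mp hi)]

/-- While the source is on, the value grows by one at each step, up to the carries emitted by the
last digit. -/
theorem counterValue_iterate (x : Config 4 (n + 2)) (hx : cellState x 0 / 2 = 1) (t : ℕ) :
    counterValue n ((counterMap n)^[t] x) +
        2 ^ n * ∑ u ∈ Finset.range t, cellState ((counterMap n)^[u] x) n / 2 =
      counterValue n x + t := by
  induction t with
  | zero => simp [Function.iterate_zero]
  | succ t ih =>
    have h := counterValue_map ((counterMap n)^[t] x)
    rw [cellState_iterate_zero, hx] at h
    rw [Function.iterate_succ_apply', Finset.sum_range_succ, mul_add]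
    linarith

/-- Over a period the value returns, so the `p` units received equal `2 ^ n` times the number of
carries emitted at the end. -/
theorem pow_le_of_isPeriodicPt {x : Config 4 (n + 2)} (hx : cellState x 0 / 2 = 1) {p : ℕ}
    (hp : 0 < p) (h : Function.IsPeriodicPt (counterMap n) p x) : 2 ^ n ≤ p := by
  have h1 := counterValue_iterate x hx p
  rw [h.eq] at h1
  exact Nat.le_of_dvd hp ⟨_, (add_left_cancel h1).symm⟩

/-- The configuration of the counter with all digits zero and the source on. -/
def counterStart (n : ℕ) : Config 4 (n + 2) := fun i => if i = 0 then 2 else 0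

theorem cellState_counterStart_zero : cellState (counterStart n) 0 / 2 = 1 := by
  simp [cellState, counterStart]

theorem cellState_counterStart_succ (i : ℕ) : cellState (counterStart n) (i + 1) = 0 := by
  simp [cellState, counterStart, Fin.ext_iff]

theorem counterValue_counterStart : counterValue n (counterStart n) = 0 := by
  simp [counterValue, cellState_counterStart_succ]

/-- The low bit of the latch is replaced by its disjunction with the incoming carry, so once set it
stays set. -/
theorem latch_mod_two_mono (x : Config 4 (n + 2)) {t u : ℕ} (htu : t ≤ u)
    (h : cellState ((counterMap n)^[u] x) (n + 1) % 2 = 0) :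
    cellState ((counterMap n)^[t] x) (n + 1) % 2 = 0 := by
  induction u, htu using Nat.le_induction with
  | base => exact h
  | succ u _ ih =>
    apply ih
    have := cellState_lt ((counterMap n)^[u] x) n
    rw [Function.iterate_succ_apply', cellState_map_latch] at h
    omega

theorem latch_eq_zero_of_lt (hn : 0 < n) {t : ℕ} (ht : t < 2 ^ n) :
    cellState ((counterMap n)^[t] (counterStart n)) (n + 1) = 0 := by
  induction t with
  | zero => exact cellState_counterStart_succ n
  | succ t ih =>
    rw [Function.iterate_succ_apply', cellState_map_latch, ih (by omega)]
    have h1 := counterValue_iterate (counterStart n) cellState_counterStart_zero t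
    rw [counterValue_counterStart] at h1
    obtain ⟨k, rfl⟩ : ∃ k, n = k + 1 := ⟨n - 1, by omega⟩
    have h2 : 2 ^ k * cellState ((counterMap (k + 1))^[t] (counterStart (k + 1))) (k + 1) ≤
        counterValue (k + 1) ((counterMap (k + 1))^[t] (counterStart (k + 1))) :=
      Finset.single_le_sum (f := fun i => 2 ^ i * cellState
        ((counterMap (k + 1))^[t] (counterStart (k + 1))) (i + 1))
        (fun i _ => Nat.zero_le _) (Finset.self_mem_range_succ k)
    -- A carry in the last digit would make the value at least `2 ^ (k + 1)`, but the value at time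
    -- `t` is at most `t`.
    have h3 : cellState ((counterMap (k + 1))^[t] (counterStart (k + 1))) (k + 1) < 2 := by
      by_contra hge
      have h4 := Nat.mul_le_mul_left (2 ^ k) (not_lt.mp hge)
      rw [pow_succ] at ht
      omega
    omega

theorem pow_le_transientLength_counter (hn : 0 < n) :
    2 ^ n ≤ transientLength (counterMap n) (counterStart n) := by
  refine le_transientLength fun t ht => ?_
  by_contra hlt
  obtain ⟨p, hp, hpt⟩ := ht
  -- If the orbit were periodic from a time `t < 2 ^ n` on, the latch would be clear again at time
  -- `p + t`. Then no carry was emitted before, so the value still equals the elapsed time and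
  -- cannot be the same at times `t` and `p + t`.
  have hlatch : cellState ((counterMap n)^[p + t] (counterStart n)) (n + 1) = 0 := by
    rw [Function.iterate_add_apply, hpt.eq]
    exact latch_eq_zero_of_lt hn (not_le.mp hlt)
  have hcarry : ∀ u < p + t, cellState ((counterMap n)^[u] (counterStart n)) n / 2 = 0 := by
    intro u hu
    have h := latch_mod_two_mono (counterStart n) (Nat.succ_le_of_lt hu) (by rw [hlatch])
    have := cellState_lt ((counterMap n)^[u] (counterStart n)) n
    rw [Function.iterate_succ_apply', cellState_map_latch] at h
    omega
  have hval : ∀ u ≤ p + t, counterValue n ((counterMap n)^[u] (counterStart n)) = u := by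
    intro u hu
    have h := counterValue_iterate (counterStart n) cellState_counterStart_zero u
    rw [counterValue_counterStart, Finset.sum_eq_zero fun v hv =>
      hcarry v ((Finset.mem_range.mp hv).trans_le hu)] at h
    simpa using h
  have h1 := hval (p + t) le_rfl
  rw [Function.iterate_add_apply, hpt.eq, hval t (by omega)] at h1
  omega

/-- The source never changes, so it is still on in the cycle finally reached. -/
theorem exists_periodic_counter (n : ℕ) : ∃ x ∈ Function.periodicPts (counterMap n),
    2 ^ n ≤ Function.minimalPeriod (counterMap n) x := by
  obtain ⟨t, ht⟩ := exists_iterate_mem_periodicPts (counterMap n) (counterStart n)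
  refine ⟨_, ht, pow_le_of_isPeriodicPt ?_ (Function.minimalPeriod_pos_of_mem_periodicPts ht)
    (Function.isPeriodicPt_minimalPeriod _ _)⟩
  rw [cellState_iterate_zero, cellState_counterStart_zero]

/-- Without carries, nothing moves. -/
theorem counter_map_eq_self {x : Config 4 (n + 2)} (hx : ∀ i, (x i : ℕ) < 2) :
    counterMap n x = x := by
  funext i
  have h1 := hx i
  have h2 := hx (predCell i)
  ext
  simp only [counterMap, counterRule, addCarry, latchCarry]
  split_ifs
  · rfl
  · change (x i : ℕ) % 2 + (x (predCell i) : ℕ) / 2 = _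
    omega
  · change max ((x i : ℕ) % 2) ((x (predCell i) : ℕ) / 2) +
      2 * min ((x i : ℕ) % 2) ((x (predCell i) : ℕ) / 2) = _
    omega

theorem exists_fixed_counter (n : ℕ) : ∃ s : Finset (Config 4 (n + 2)),
    (∀ x ∈ s, counterMap n x = x) ∧ 2 ^ n ≤ s.card := by
  classical
  -- Configurations with states `0` and `1` only carry nothing, the source included.
  refine ⟨(Finset.univ : Finset (Config 2 (n + 2))).image
    fun y i => Fin.castLE (by norm_num) (y i), ?_, ?_⟩
  · intro x hx
    obtain ⟨y, -, rfl⟩ := Finset.mem_image.mp hx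
    exact counter_map_eq_self fun i => (y i).2
  · rw [Finset.card_image_of_injective]
    · simpa using Nat.pow_le_pow_right (n := 2) (by norm_num) (Nat.le_add_right n 2)
    · intro y z h
      funext i
      exact Fin.castLE_injective _ (congrFun h i)

theorem counter_mem_boundedDegreeFamily (n : ℕ) : counter n ∈ (boundedDegreeFamily 4 3).nets := by
  refine ⟨Nat.succ_pos _, ⟨fun u v : Fin (n + 2) => u = v ∨ (u : ℕ) + 1 = v⟩, ?_, ?_⟩
  · intro v
    refine ⟨fun y => counterRule n v (y ⟨v, Or.inl rfl⟩) (y ⟨predCell v, ?_⟩), fun x => rfl⟩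
    -- Truncated subtraction makes cell `0` its own predecessor, which is covered by the loop at
    -- `v`.
    by_cases hv : (v : ℕ) = 0
    · exact Or.inl (Fin.ext (by simp [predCell, hv]))
    · exact Or.inr (by simp only [predCell]; omega)
  · intro (v : Fin (n + 2))
    have hinj : Set.InjOn (fun u : Fin (n + 2) => (u : ℕ)) Set.univ :=
      fun _ _ _ _ h => Fin.ext h
    refine (Set.ncard_le_ncard_of_injOn (t := (({(v : ℕ) - 1, (v : ℕ), (v : ℕ) + 1} : Finset ℕ) :
      Set ℕ)) (fun u : Fin (n + 2) => (u : ℕ)) ?_ (hinj.mono (Set.subset_univ _))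
      (Finset.finite_toSet _)).trans ?_
    · intro (u : Fin (n + 2)) hu
      have hu' : (u = v ∨ (u : ℕ) + 1 = (v : ℕ)) ∨ (v = u ∨ (v : ℕ) + 1 = (u : ℕ)) := hu
      rw [Fin.ext_iff, Fin.ext_iff] at hu'
      simp only [Finset.coe_insert, Finset.coe_singleton, Set.mem_insert_iff,
        Set.mem_singleton_iff]
      omega
    · rw [Set.ncard_coe_finset]
      exact Finset.card_le_three

end Counter

theorem SimulatesVia.hasRichDynamics_counter {q n : ℕ} (hn : 0 < n) {G : Network q}
    {φ : BlockEmbedding 4 (counter n).nodes q G.nodes} {T : ℕ} (h : SimulatesVia G (counter n) φ T)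
    {b : ℝ} (hb₀ : 0 ≤ b) (hb : b * T ≤ 2 ^ n) {L : ℕ} (hL : T ≤ L) : HasRichDynamics G b L := by
  obtain ⟨s, hs, hcard⟩ := exists_fixed_counter n
  exact h.hasRichDynamics (N := 2 ^ n) hb₀ (by exact_mod_cast hb) (exists_periodic_counter n)
    ⟨_, pow_le_transientLength_counter hn⟩ s hs hcard hL

/-! ### Building circuits -/

namespace Gate

variable {V W : Type}

/-- Renaming of the vertices read by a gate. -/
def map (e : V → W) : Gate V → Gate W
  | .const b => .const b
  | .not u => .not (e u)
  | .and u v => .and (e u) (e v)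
  | .or u v => .or (e u) (e v)

theorem sources_map (e : V → W) (g : Gate V) : (g.map e).sources = g.sources.map e := by
  cases g <;> rfl

theorem value_map (e : V → W) (g : Gate V) (f : W → Bool) :
    (g.map e).value (fun u _ => f u) = g.value fun u _ => f (e u) := by
  cases g <;> rfl

theorem value_congr (g : Gate V) {f f' : V → Bool} (h : ∀ u ∈ g.sources, f u = f' u) :
    g.value (fun u _ => f u) = g.value fun u _ => f' u := by
  congr 1
  funext u hu
  exact h u hu

end Gate

/-- Gates indexed by an arbitrary finite type, each reading gates of smaller rank, form a
circuit. -/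
theorem exists_circuit {I O : ℕ} {κ : Type} [Fintype κ] (gate : κ → Gate (Fin I ⊕ κ))
    (out : Fin O → Fin I ⊕ κ) (rank : κ → ℕ)
    (hrank : ∀ i j, Sum.inr i ∈ (gate j).sources → rank i < rank j) :
    ∃ C : Circuit I O, C.gates = Fintype.card κ ∧
      ∀ (x : Fin I → Bool) (v : κ → Bool),
        (∀ j, v j = (gate j).value fun u _ => Sum.elim x v u) →
        ∀ o, C.eval x o = Sum.elim x v (out o) := by
  let e := Fintype.equivFin κ
  let C : Circuit I O :=
    { gates := Fintype.card κ
      gate := fun j => (gate (e.symm j)).map (Sum.map id e)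
      out := fun o => Sum.map id e (out o)
      acyclic := by
        refine Subrelation.wf ?_ (measure fun j => rank (e.symm j)).wf
        intro i j hij
        rw [Gate.sources_map] at hij
        obtain ⟨u, hu, hui⟩ := List.mem_map.mp hij
        cases u with
        | inl a => simp at hui
        | inr k =>
          obtain rfl : e k = i := by simpa using hui
          exact hrank _ _ (by simpa using hu) }
  refine ⟨C, rfl, fun x v hv o => ?_⟩
  -- The gate equations have only one solution, by induction on the rank; so any `v` satisfying them
  -- gives the values of the gates.
  have key : ∀ r, ∀ k, rank (e.symm k) < r → C.vertexValue x (.inr k) = v (e.symm k) := by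
    intro r
    induction r with
    | zero => intro k hk; omega
    | succ r ih =>
      intro k hk
      rw [C.vertexValue_inr, hv]
      change ((gate (e.symm k)).map (Sum.map id e)).value (fun u _ => C.vertexValue x u) = _
      rw [Gate.value_map]
      refine Gate.value_congr _ fun u hu => ?_
      cases u with
      | inl a => rfl
      | inr l =>
        have h := ih (e l) (by have := hrank l _ hu; rw [e.symm_apply_apply]; omega)
        rwa [e.symm_apply_apply] at h
  change C.vertexValue x (Sum.map id e (out o)) = _
  cases out o with
  | inl a => rfl
  | inr k => exact (key _ (e k) (Nat.lt_succ_self _)).trans (congrArg v (e.symm_apply_apply k))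

theorem bitWidth_two : bitWidth 2 = 1 := by
  simp [bitWidth, Nat.clog_of_two_le]

theorem bitWidth_four : bitWidth 4 = 2 := by
  have : Nat.clog 2 4 = 2 := by
    simpa using Nat.clog_pow 2 2 (by norm_num)
  simp [bitWidth, this]

theorem le_two_pow_bitWidth (q : ℕ) : q ≤ 2 ^ bitWidth q :=
  (Nat.le_pow_clog (by norm_num) q).trans
    (Nat.pow_le_pow_right (by norm_num) (le_max_right _ _))

theorem configBits_finProdFinEquiv {q n : ℕ} (x : Config q n) (i : Fin n) (j : Fin (bitWidth q)) :
    configBits x (finProdFinEquiv (i, j)) = (x i : ℕ).testBit j := by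
  have h := finProdFinEquiv.symm_apply_apply (i, j)
  rw [finProdFinEquiv_symm_apply, Prod.mk.injEq] at h
  rw [configBits, h.1, h.2]

theorem configBits_injective {q n : ℕ} : Function.Injective (configBits (q := q) (n := n)) := by
  intro x y h
  funext i
  apply Fin.ext
  refine Nat.eq_of_testBit_eq fun j => ?_
  by_cases hj : j < bitWidth q
  · have := congrFun h (finProdFinEquiv (i, ⟨j, hj⟩))
    rwa [configBits_finProdFinEquiv, configBits_finProdFinEquiv] at this
  · have hlt : ∀ a : Fin q, (a : ℕ) < 2 ^ j := fun a =>
      (a.2.trans_le (le_two_pow_bitWidth q)).trans_le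
        (Nat.pow_le_pow_right (by norm_num) (not_lt.mp hj))
    rw [Nat.testBit_lt_two_pow (hlt _), Nat.testBit_lt_two_pow (hlt _)]

/-- The gates used for one cell of the counter: disjunction and conjunction of the digit with the
incoming carry, then their exclusive disjunction. -/
def cellGate {V : Type} (b c : V) : Fin 4 → Gate (V ⊕ Fin 4)
  | 0 => .or (.inl b) (.inl c)
  | 1 => .and (.inl b) (.inl c)
  | 2 => .not (.inr 1)
  | 3 => .and (.inr 0) (.inr 2)

/-- The bits read by the gates of the counter. -/
def counterBit {n : ℕ} (i : Fin n) (j : ℕ) (hj : j < 2) : Fin (n * bitWidth 4) :=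
  finProdFinEquiv (i, ⟨j, by rw [bitWidth_four]; exact hj⟩)

theorem lt_of_mem_sources_cellGate {V : Type} {b c : V} {i j : Fin 4}
    (h : Sum.inr i ∈ (cellGate b c j).sources) : i < j := by
  fin_cases j <;> simp [cellGate, Gate.sources] at h
  · subst h; decide
  · rcases h with rfl | rfl <;> decide

theorem exists_circuit_counterMap (n : ℕ) :
    ∃ C : Circuit ((n + 2) * bitWidth 4) ((n + 2) * bitWidth 4),
      EncodesMap C (counterMap n) ∧ C.gates = (n + 2) * 4 := by
  let N := n + 2
  let κ := Fin N × Fin 4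
  let dig : Fin N → Fin (N * bitWidth 4) := fun i => counterBit i 0 (by norm_num)
  let car : Fin N → Fin (N * bitWidth 4) := fun i => counterBit i 1 (by norm_num)
  let gate : κ → Gate (Fin (N * bitWidth 4) ⊕ κ) := fun k =>
    (cellGate (dig k.1) (car (predCell k.1)) k.2).map (Sum.map id fun a => (k.1, a))
  -- The source copies its input bits. Elsewhere the high bit is the conjunction for both rules; the
  -- low bit is the exclusive disjunction in the counter and the disjunction in the latch.
  let out : Fin (N * bitWidth 4) → Fin (N * bitWidth 4) ⊕ κ := fun o =>
    if (o.divNat : ℕ) = 0 then .inl o else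
      if (o.modNat : ℕ) = 0 then
        if (o.divNat : ℕ) ≤ n then .inr (o.divNat, 3) else .inr (o.divNat, 0)
      else .inr (o.divNat, 1)
  -- Gates read only input bits and earlier gates of the same cell, so the index within the cell is
  -- a rank.
  obtain ⟨C, hC, hval⟩ := exists_circuit gate out (fun k => k.2) (by
    rintro ⟨i, a⟩ ⟨j, b⟩ h
    rw [Gate.sources_map] at h
    obtain ⟨u, hu, hui⟩ := List.mem_map.mp h
    cases u with
    | inl a => simp at hui
    | inr c =>
      obtain ⟨rfl, rfl⟩ := Prod.mk.inj (Sum.inr.inj hui)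
      exact lt_of_mem_sources_cellGate hu)
  refine ⟨C, fun x => ?_, ?_⟩
  · let v : κ → Bool := fun k =>
      let b := (x k.1 : ℕ).testBit 0
      let c := (x (predCell k.1) : ℕ).testBit 1
      match k.2 with
      | 0 => b || c
      | 1 => b && c
      | 2 => !(b && c)
      | 3 => (b || c) && !(b && c)
    have hdig : ∀ i, configBits x (dig i) = (x i : ℕ).testBit 0 := fun i =>
      configBits_finProdFinEquiv x i _
    have hcar : ∀ i, configBits x (car i) = (x i : ℕ).testBit 1 := fun i =>
      configBits_finProdFinEquiv x i _
    funext o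
    rw [hval (configBits x) v]
    · have hadd0 : ∀ s p : Fin 4, ((addCarry s p : Fin 4) : ℕ).testBit 0 =
          (((s : ℕ).testBit 0 || (p : ℕ).testBit 1) &&
            !((s : ℕ).testBit 0 && (p : ℕ).testBit 1)) := by decide
      have hadd1 : ∀ s p : Fin 4, ((addCarry s p : Fin 4) : ℕ).testBit 1 =
          ((s : ℕ).testBit 0 && (p : ℕ).testBit 1) := by decide
      have hlat0 : ∀ s p : Fin 4, ((latchCarry s p : Fin 4) : ℕ).testBit 0 =
          ((s : ℕ).testBit 0 || (p : ℕ).testBit 1) := by decide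
      have hlat1 : ∀ s p : Fin 4, ((latchCarry s p : Fin 4) : ℕ).testBit 1 =
          ((s : ℕ).testBit 0 && (p : ℕ).testBit 1) := by decide
      have hmod : (o.modNat : ℕ) = 0 ∨ (o.modNat : ℕ) = 1 := by
        have h : (o.modNat : ℕ) < 2 := o.modNat.2.trans_eq bitWidth_four
        omega
      have hrhs : configBits (counterMap n x) o =
          ((counterRule n (o.divNat : Fin N) (x o.divNat) (x (predCell o.divNat)) : Fin 4) :
            ℕ).testBit o.modNat := rfl
      rw [hrhs]
      simp only [out, counterRule]
      split_ifs with h0 h1 h2 h2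
      · rfl
      · simp only [h1, hadd0]; rfl
      · simp only [h1, hlat0]; rfl
      · simp only [hmod.resolve_left h1, hadd1]; rfl
      · simp only [hmod.resolve_left h1, hlat1]; rfl
    · rintro ⟨i, a⟩
      rw [Gate.value_map]
      fin_cases a <;> simp [cellGate, Gate.value, v, hdig, hcar]
  · rw [hC, Fintype.card_prod, Fintype.card_fin, Fintype.card_fin]

theorem counter_isSuccinct (n : ℕ) : IsSuccinct (fun m => m * 6) (counter n) := by
  obtain ⟨C, hC, hg⟩ := exists_circuit_counterMap n
  refine ⟨C, hC, ?_⟩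
  -- Each cell costs two input bits and four gates, hence the factor `6`.
  change (n + 2) * bitWidth 4 + C.gates ≤ (n + 2) * 6
  rw [hg, bitWidth_four]
  omega

/-! ### Members of the simulated families -/

theorem Family.Simulates.exists_mem {qA qB : ℕ} {A : Family qA} {B : Family qB} {T S : ℕ → ℕ}
    (hA : A.IsStandard) (h : A.Simulates B T S) {F : Network qB} (hF : ∃ w, B.Represents w F) :
    ∃ G ∈ A.nets, G.nodes = S F.nodes ∧ ∃ φ, SimulatesVia G F φ (T F.nodes) := by
  obtain ⟨f, -, hf⟩ := h
  obtain ⟨w, hw⟩ := hF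
  obtain ⟨u, G, φ, hu, hG, hsim, -⟩ := hf w F hw
  exact ⟨G, hA.mem u G hu, hG, φ, hsim⟩

theorem exists_represents_circuitFamily {q : ℕ} {P : ℕ → ℕ} {F : Network q} (hF : 0 < F.nodes)
    (h : IsSuccinct P F) : ∃ w, (circuitFamily q P).Represents w F := by
  obtain ⟨C, hC, hsize⟩ := h
  exact ⟨C.code, hF, C, hC, hsize, rfl⟩

/-- Enumerating the in-neighbors of each node turns a communication graph into lists and tables with
the same graph, so the degree bound is kept. -/
theorem exists_localData {q n Δ : ℕ} {F : Config q n → Config q n} {G : Digraph (Fin n)}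
    (hF : IsCommunicationGraph G F) (hG : DegreeLE G Δ) :
    ∃ R : LocalData q n, DegreeLE R.graph Δ ∧ R.map = F := by
  classical
  choose f hf using hF
  let e := fun v => Fintype.equivFin {u // G.Adj u v}
  let R : LocalData q n :=
    { deg := fun v => Fintype.card {u // G.Adj u v}
      nbr := fun v i => ((e v).symm i).1
      nbr_injective := fun v => Subtype.val_injective.comp (e v).symm.injective
      loc := fun v y => f v fun u => y (e v u) }
  have hadj : ∀ u v, R.graph.Adj u v ↔ G.Adj u v := by
    intro u v
    constructor
    · rintro ⟨i, rfl⟩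
      exact ((e v).symm i).2
    · intro h
      exact ⟨e v ⟨u, h⟩, congrArg Subtype.val ((e v).symm_apply_apply ⟨u, h⟩)⟩
  refine ⟨R, ?_, ?_⟩
  · intro v
    simp only [hadj]
    exact hG v
  · funext x v
    rw [hf]
    change f v (fun u => x ((e v).symm (e v u)).1) = _
    simp only [Equiv.symm_apply_apply]

theorem exists_represents_boundedDegreeFamily {q Δ : ℕ} {F : Network q}
    (hF : F ∈ (boundedDegreeFamily q Δ).nets) :
    ∃ w, (boundedDegreeFamily q Δ).Represents w F := by
  obtain ⟨hpos, G, hG, hΔ⟩ := hF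
  obtain ⟨R, hR, hmap⟩ := exists_localData hG hΔ
  exact ⟨R.code, hpos, R, hR, hmap, rfl⟩

/-- Transport along an equality of numbers of bits, needed because `N * bitWidth 2` and `N` are only
propositionally equal. -/
theorem Circuit.exists_cast {I J : ℕ} (h : I = J) (C : Circuit I I) :
    ∃ D : Circuit J J, D.gates = C.gates ∧
      ∀ x o, D.eval x o = C.eval (fun i => x (Fin.cast h i)) (Fin.cast h.symm o) := by
  subst h
  exact ⟨C, rfl, fun _ _ => rfl⟩

theorem configBits_two {n : ℕ} (y : Config 2 n) (j : Fin (n * bitWidth 2)) :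
    configBits y j = (y (Fin.cast (by rw [bitWidth_two, mul_one]) j) : ℕ).testBit 0 := by
  have h1 : j.divNat = Fin.cast (by rw [bitWidth_two, mul_one]) j := by
    ext
    simp [bitWidth_two]
  have h2 : (j.modNat : ℕ) = 0 := Nat.lt_one_iff.mp (j.modNat.2.trans_eq bitWidth_two)
  rw [configBits, h1, h2]

/-- Bits as letters of the binary alphabet. -/
def bitLetter (b : Bool) : Fin 2 := if b then 1 else 0

theorem testBit_bitLetter (b : Bool) : (bitLetter b : ℕ).testBit 0 = b := by
  cases b <;> rfl

/-- A succinct network over any alphabet embeds into a binary network computed by the same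
circuit. -/
theorem exists_binary_network {k : ℕ} {ρ : ℕ → ℕ} {F : Network k} (hF : 0 < F.nodes)
    (h : IsSuccinct ρ F) :
    ∃ B : Network 2, B.nodes = F.nodes * bitWidth k ∧ B.nodes ≤ ρ F.nodes ∧ 0 < B.nodes ∧
      IsSuccinct (fun _ => ρ F.nodes) B ∧
      IsSubgraphOf (orbitGraph F.map) (orbitGraph B.map) := by
  obtain ⟨C, hC, hsize⟩ := h
  let N := F.nodes * bitWidth k
  let B : Network 2 := ⟨N, fun y j => bitLetter (C.eval (fun i => (y i : ℕ).testBit 0) j)⟩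
  have hN : N * bitWidth 2 = N := by rw [bitWidth_two, mul_one]
  have hpos : 0 < N := Nat.mul_pos hF (lt_of_lt_of_le one_pos (le_max_left _ _))
  -- Inputs count in the size of a circuit, so the number of bits is at most `ρ F.nodes`.
  refine ⟨B, rfl, (Nat.le_add_right _ _).trans hsize, hpos, ?_, ?_⟩
  · obtain ⟨D, hD, hval⟩ := C.exists_cast hN.symm
    refine ⟨D, fun y => ?_, ?_⟩
    · funext o
      refine (hval _ o).trans ?_
      rw [configBits_two]
      refine Eq.trans ?_ (testBit_bitLetter _).symm
      congr 1
      funext i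
      exact configBits_two y _
    · change N * bitWidth 2 + D.gates ≤ ρ F.nodes
      have hle : F.nodes * bitWidth k + C.gates ≤ ρ F.nodes := hsize
      omega
  · refine isSubgraphOf_of_semiconj (φ := fun x j => bitLetter (configBits x j)) ?_ ?_
    · intro x
      funext j
      change bitLetter (configBits (F.map x) j) =
        bitLetter (C.eval (fun i => (bitLetter (configBits x i) : ℕ).testBit 0) j)
      simp only [testBit_bitLetter]
      rw [hC]
    · intro x y hxy
      refine configBits_injective (funext fun j => ?_)
      rw [← testBit_bitLetter (configBits x j), ← testBit_bitLetter (configBits y j)]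
      exact congrArg (fun a : Fin 2 => (a : ℕ).testBit 0) (congrFun hxy j)

/-! ### Growth of functions -/

theorem eval_mono (p : Polynomial ℕ) {a b : ℕ} (h : a ≤ b) : p.eval a ≤ p.eval b := by
  rw [Polynomial.eval_eq_sum, Polynomial.eval_eq_sum]
  exact Finset.sum_le_sum fun i _ => Nat.mul_le_mul_left _ (Nat.pow_le_pow_left h i)

theorem eval_le_mul_pow (p : Polynomial ℕ) :
    ∃ C d : ℕ, ∀ n, p.eval n ≤ C * (n + 1) ^ d := by
  refine ⟨∑ i ∈ p.support, p.coeff i, p.natDegree, fun n => ?_⟩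
  rw [Polynomial.eval_eq_sum, Polynomial.sum, Finset.sum_mul]
  refine Finset.sum_le_sum fun i hi => Nat.mul_le_mul_left _ ?_
  exact (Nat.pow_le_pow_left (Nat.le_succ n) i).trans
    (Nat.pow_le_pow_right (Nat.succ_pos n) (Polynomial.le_natDegree_of_mem_supp i hi))

theorem exists_eval_shift_le (p : Polynomial ℕ) :
    ∃ C d : ℕ, ∀ n, 0 < n → p.eval (n + 2) ≤ C * n ^ d := by
  obtain ⟨C, d, h⟩ := eval_le_mul_pow p
  -- For `n ≥ 1` one has `n + 3 ≤ 4 * n`.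
  refine ⟨C * 4 ^ d, d, fun n hn => (h _).trans ?_⟩
  rw [mul_assoc, ← mul_pow]
  exact Nat.mul_le_mul_left _ (Nat.pow_le_pow_left (by omega) d)

theorem eventually_eval_shift_le (p : Polynomial ℕ) :
    ∀ᶠ n : ℕ in Filter.atTop, ((p.eval (n + 2) : ℕ) : ℝ) ≤ (2 : ℝ) ^ ((n : ℝ) / 2) := by
  obtain ⟨C, d, h⟩ := exists_eval_shift_le p
  have hlim := (tendsto_pow_const_div_const_pow_of_one_lt d
    (Real.one_lt_rpow one_lt_two (by norm_num : (0 : ℝ) < 1 / 2))).const_mul (C : ℝ)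
  rw [mul_zero] at hlim
  filter_upwards [hlim.eventually_le_const one_pos, Filter.eventually_gt_atTop 0] with n hn hpos
  have h2 : (2 : ℝ) ^ ((n : ℝ) / 2) = ((2 : ℝ) ^ (1 / 2 : ℝ)) ^ n := by
    rw [← Real.rpow_natCast, ← Real.rpow_mul (by norm_num)]
    congr 1
    ring
  have h3 : (0 : ℝ) < ((2 : ℝ) ^ (1 / 2 : ℝ)) ^ n := by positivity
  rw [← mul_div_assoc, div_le_one h3] at hn
  rw [h2]
  refine le_trans ?_ hn
  exact_mod_cast h n hpos

theorem exists_eventually_rpow_le (p : Polynomial ℕ) : ∃ α : ℝ, 0 < α ∧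
    ∀ᶠ n : ℕ in Filter.atTop, ((p.eval (n + 2) : ℕ) : ℝ) ^ α ≤ (n : ℝ) / 2 := by
  obtain ⟨C, d, h⟩ := exists_eval_shift_le p
  -- One degree more than `d` absorbs the constants: `C * n ^ d ≤ (n / 2) ^ (d + 1)` as soon as `n ≥
  -- C * 2 ^ (d + 1)`.
  refine ⟨((d + 1 : ℕ) : ℝ)⁻¹, by positivity, ?_⟩
  filter_upwards [Filter.eventually_ge_atTop (C * 2 ^ (d + 1)), Filter.eventually_gt_atTop 0]
    with n hn hpos
  have h1 : ((p.eval (n + 2) : ℕ) : ℝ) ≤ ((n : ℝ) / 2) ^ (d + 1) := by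
    rw [div_pow, le_div_iff₀ (by positivity), pow_succ (n : ℝ)]
    calc ((p.eval (n + 2) : ℕ) : ℝ) * 2 ^ (d + 1) ≤ (C * n ^ d) * 2 ^ (d + 1) := by
          gcongr
          exact_mod_cast h n hpos
      _ = n ^ d * (C * 2 ^ (d + 1)) := by ring
      _ ≤ n ^ d * n := by
          gcongr
          exact_mod_cast hn
  calc ((p.eval (n + 2) : ℕ) : ℝ) ^ ((d + 1 : ℕ) : ℝ)⁻¹
      ≤ (((n : ℝ) / 2) ^ (d + 1)) ^ ((d + 1 : ℕ) : ℝ)⁻¹ := by gcongr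
    _ = (n : ℝ) / 2 := Real.pow_rpow_inv_natCast (by positivity) (Nat.succ_ne_zero d)

theorem IsLinearlyBounded.isPolyBounded {f : ℕ → ℕ} (h : IsLinearlyBounded f) :
    IsPolyBounded f := by
  obtain ⟨c, hc⟩ := h
  exact ⟨Polynomial.C c * Polynomial.X + Polynomial.C c, fun n => by simpa using hc n⟩

theorem IsLinearlyBounded.add {f g : ℕ → ℕ} (hf : IsLinearlyBounded f)
    (hg : IsLinearlyBounded g) : IsLinearlyBounded fun n => f n + g n := by
  obtain ⟨c, hc⟩ := hf
  obtain ⟨d, hd⟩ := hg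
  refine ⟨c + d, fun n => ?_⟩
  calc f n + g n ≤ (c * n + c) + (d * n + d) := add_le_add (hc n) (hd n)
    _ = (c + d) * n + (c + d) := by ring

/-! ### Consequences of universality -/

/-- If a family simulates the counters, and `a` is at most `n / 2` on the size of the
network simulating the one with `n` digits, then it contains networks with rich dynamics. -/
theorem exists_hasRichDynamics {q : ℕ} {A : Family q} (hA : A.IsStandard) {B : Family 4}
    {T S : ℕ → ℕ} (h : A.Simulates B T S) (hB : ∀ n, ∃ w, B.Represents w (counter n))
    (hT : IsPolyBounded T) {L : ℕ → ℕ} (hL : ∀ n m, n ≤ m → T n ≤ L m) {a : ℕ → ℝ}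
    (ha : ∀ᶠ n : ℕ in Filter.atTop, a (S (n + 2)) ≤ (n : ℝ) / 2) (M : ℕ) :
    ∃ H ∈ A.nets, M ≤ H.nodes ∧ HasRichDynamics H ((2 : ℝ) ^ a H.nodes) (L H.nodes) := by
  obtain ⟨p, hp⟩ := hT
  obtain ⟨n, hn, hTn, hM, hpos⟩ := (ha.and ((eventually_eval_shift_le p).and
    ((Filter.eventually_ge_atTop M).and (Filter.eventually_gt_atTop 0)))).exists
  obtain ⟨G, hG, hS, φ, hφ⟩ := h.exists_mem hA (hB n)
  have hnodes : n + 2 ≤ G.nodes := φ.nodes_le (by norm_num)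
  refine ⟨G, hG, by omega, hφ.hasRichDynamics_counter hpos (by positivity) ?_ (hL _ _ hnodes)⟩
  have hS' : G.nodes = S (n + 2) := hS
  rw [hS']
  -- One factor `2 ^ (n / 2)` bounds the number of orbits wanted, the other one the simulation time.
  calc (2 : ℝ) ^ a (S (n + 2)) * (T (n + 2) : ℕ)
      ≤ 2 ^ ((n : ℝ) / 2) * 2 ^ ((n : ℝ) / 2) := by
        gcongr
        · norm_num
        · exact le_trans (by exact_mod_cast hp (n + 2)) hTn
    _ = 2 ^ n := by
        rw [← Real.rpow_add (by norm_num), add_halves, Real.rpow_natCast]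

theorem Family.IsUniversal.exists_embedding {q : ℕ} {A : Family q} (hA : A.IsStandard)
    (hU : A.IsUniversal) {ρ : ℕ → ℕ} (hρ : IsPolyBounded ρ) : ∃ δ : ℕ → ℕ, IsPolyBounded δ ∧
      ∀ k : ℕ, 0 < k → ∀ F : Network k, 0 < F.nodes → IsSuccinct ρ F →
        ∃ H ∈ A.nets, EmbedsWithDistortion δ F H := by
  obtain ⟨p, hp⟩ := hρ
  obtain ⟨T, S, ⟨t, ht⟩, ⟨s, hs⟩, hsim⟩ :=
    hU 2 two_pos (fun n => p.eval n) ⟨p, fun _ => le_rfl⟩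
  refine ⟨fun n => ((t + s).comp p).eval n, ⟨_, fun _ => le_rfl⟩, fun k _ F hF hsucc => ?_⟩
  obtain ⟨B, hB, hBρ, hBpos, ⟨C, hC, hsize⟩, hsub⟩ := exists_binary_network hF hsucc
  have hnB : F.nodes ≤ B.nodes := by
    rw [hB]
    exact Nat.le_mul_of_pos_right _ (lt_of_lt_of_le one_pos (le_max_left _ _))
  have hBp : B.nodes ≤ p.eval F.nodes := hBρ.trans (hp _)
  -- The circuit size is bounded in terms of `F.nodes`; as `F.nodes ≤ B.nodes` and `p` is monotone,
  -- `B` belongs to the binary family with bound `p`.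
  obtain ⟨H, hH, hHS, φ, hφ⟩ := hsim.exists_mem hA (exists_represents_circuitFamily hBpos
    ⟨C, hC, (hsize.trans (hp _)).trans (eval_mono p hnB)⟩)
  have hbound : t.eval B.nodes + s.eval B.nodes ≤ ((t + s).comp p).eval F.nodes := by
    rw [Polynomial.eval_comp, Polynomial.eval_add]
    exact add_le_add (eval_mono t hBp) (eval_mono s hBp)
  have h1 := ht B.nodes
  have h2 := hs B.nodes
  exact ⟨H, hH, by change H.nodes ≤ ((t + s).comp p).eval F.nodes; omega, T B.nodes, hφ.1,
    by change _ ≤ ((t + s).comp p).eval F.nodes; omega,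
    hsub.trans (isSubgraphOf_of_semiconj hφ.semiconj φ.toFun_injective)⟩

theorem Family.IsUniversal.exists_hasRichDynamics {q : ℕ} {A : Family q} (hA : A.IsStandard)
    (hU : A.IsUniversal) : ∃ α : ℝ, 0 < α ∧ ∃ L : ℕ → ℕ, IsPolyBounded L ∧
      ∀ m : ℕ, ∃ H ∈ A.nets, m ≤ H.nodes ∧
        HasRichDynamics H ((2 : ℝ) ^ ((H.nodes : ℝ) ^ α)) (L H.nodes) := by
  obtain ⟨T, S, ⟨t, ht⟩, ⟨s, hs⟩, hsim⟩ := hU 4 (by norm_num) (fun m => m * 6)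
    ⟨Polynomial.X * Polynomial.C 6, fun n => by simp⟩
  obtain ⟨α, hα, hev⟩ := exists_eventually_rpow_le s
  refine ⟨α, hα, fun n => t.eval n, ⟨t, fun _ => le_rfl⟩, fun M => ?_⟩
  refine AutomataNet.exists_hasRichDynamics hA hsim
    (fun n => exists_represents_circuitFamily (Nat.succ_pos _) (counter_isSuccinct n)) ⟨t, ht⟩
    (fun n m hnm => (ht n).trans (eval_mono t hnm)) (a := fun m => (m : ℝ) ^ α) ?_ M
  filter_upwards [hev] with n hn
  refine le_trans ?_ hn
  gcongr
  exact hs _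

theorem Family.IsStronglyUniversal.exists_embedding {q : ℕ} {A : Family q} (hA : A.IsStandard)
    (hU : A.IsStronglyUniversal) {k : ℕ} (hk : 0 < k) {Δ : ℕ} (hΔ : 1 ≤ Δ) :
    ∃ δ : ℕ → ℕ, IsLinearlyBounded δ ∧
      ∀ F ∈ (boundedDegreeFamily k Δ).nets, ∃ H ∈ A.nets, EmbedsWithDistortion δ F H := by
  obtain ⟨T, S, hT, hS, hsim⟩ := hU k hk Δ hΔ
  refine ⟨fun n => T n + S n, hT.add hS, fun F hF => ?_⟩
  obtain ⟨H, hH, hHS, φ, hφ⟩ := hsim.exists_mem hA (exists_represents_boundedDegreeFamily hF)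
  exact ⟨H, hH, hHS.le.trans (Nat.le_add_left _ _), T F.nodes, hφ.1, Nat.le_add_right _ _,
    isSubgraphOf_of_semiconj hφ.semiconj φ.toFun_injective⟩

theorem Family.IsStronglyUniversal.exists_hasRichDynamics {q : ℕ} {A : Family q} (hA : A.IsStandard)
    (hU : A.IsStronglyUniversal) : ∃ α : ℝ, 0 < α ∧ ∃ L : ℕ → ℕ, IsLinearlyBounded L ∧
      ∀ m : ℕ, ∃ H ∈ A.nets, m ≤ H.nodes ∧
        HasRichDynamics H ((2 : ℝ) ^ (α * (H.nodes : ℝ))) (L H.nodes) := by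
  obtain ⟨T, S, hT, ⟨c, hc⟩, hsim⟩ := hU 4 (by norm_num) 3 (by norm_num)
  have hTp := hT.isPolyBounded
  obtain ⟨d, hd⟩ := hT
  -- For `n ≥ 1`, `S (n + 2) ≤ c * (n + 3) ≤ 4 * c * n`, so this `α` gives `α * S (n + 2) ≤ n / 2`.
  refine ⟨(8 * (c + 1 : ℝ))⁻¹, by positivity, fun n => d * n + d, ⟨d, fun _ => le_rfl⟩,
    fun M => ?_⟩
  refine AutomataNet.exists_hasRichDynamics hA hsim
    (fun n => exists_represents_boundedDegreeFamily (counter_mem_boundedDegreeFamily n)) hTp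
    (fun n m hnm => (hd n).trans (Nat.add_le_add_right (Nat.mul_le_mul_left d hnm) d))
    (a := fun m => (8 * (c + 1 : ℝ))⁻¹ * (m : ℝ)) ?_ M
  filter_upwards [Filter.eventually_gt_atTop 0] with n hn
  have h1 : (S (n + 2) : ℝ) ≤ c * (n + 2) + c := by exact_mod_cast hc (n + 2)
  have h2 : (1 : ℝ) ≤ n := by exact_mod_cast hn
  have h3 : (0 : ℝ) ≤ c := Nat.cast_nonneg c
  rw [inv_mul_le_iff₀ (by positivity)]
  nlinarith

end AutomataNet

theorem mainTheorem11 {q : ℕ} (A : Family q) (hA : A.IsStandard) :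
    (A.IsUniversal →
      (∀ ρ : ℕ → ℕ, IsPolyBounded ρ → ∃ δ : ℕ → ℕ, IsPolyBounded δ ∧
        ∀ k : ℕ, 0 < k → ∀ F : Network k, 0 < F.nodes → IsSuccinct ρ F →
          ∃ H ∈ A.nets, EmbedsWithDistortion δ F H) ∧
      (∃ α : ℝ, 0 < α ∧ ∃ L : ℕ → ℕ, IsPolyBounded L ∧
        ∀ m : ℕ, ∃ H ∈ A.nets, m ≤ H.nodes ∧
          HasRichDynamics H ((2 : ℝ) ^ ((H.nodes : ℝ) ^ α)) (L H.nodes))) ∧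
    (A.IsStronglyUniversal →
      (∀ k : ℕ, 0 < k → ∀ Δ : ℕ, 1 ≤ Δ → ∃ δ : ℕ → ℕ, IsLinearlyBounded δ ∧
        ∀ F ∈ (boundedDegreeFamily k Δ).nets,
          ∃ H ∈ A.nets, EmbedsWithDistortion δ F H) ∧
      (∃ α : ℝ, 0 < α ∧ ∃ L : ℕ → ℕ, IsLinearlyBounded L ∧
        ∀ m : ℕ, ∃ H ∈ A.nets, m ≤ H.nodes ∧
          HasRichDynamics H ((2 : ℝ) ^ (α * (H.nodes : ℝ))) (L H.nodes))) := by
  exact ⟨fun hU => ⟨fun _ hρ => hU.exists_embedding hA hρ, hU.exists_hasRichDynamics hA⟩,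
    fun hU => ⟨fun _ hk _ hΔ => hU.exists_embedding hA hk hΔ, hU.exists_hasRichDynamics hA⟩⟩
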